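/- Let $U(L(sl_2))$ be the universal enveloping algebra of the loop algebra $\mathbb{C}[t,t^{-1}]\otimes sl_2(\mathbb{C})$, with generators $x_k^{+}=t^k\otimes E_{12}$, $x_k^{-}=t^k\otimes E_{21}$, $h_k=t^k\otimes(E_{11}-E_{22})$ $(k\in\mathbb{Z})$, so that $[h_j,x_k^{\pm}]=\pm2x_{j+k}^{\pm}$, $[x_j^{+},x_k^{-}]=h_{j+k}$, $[h_j,h_k]=[x_j^{\pm},x_k^{\pm}]=0$. Let the Borel subalgebra $U(B)\subset U(L(sl_2))$ be the unital subalgebra generated by $h_0$, $x_0^{+}$, $x_1^{-}$; it contains $h_k$, $x_k^{+}$ for $k\ge 0$ and $x_k^{-}$ for $k\ge 1$. Let $V_B$ be a finite-dimensional complex representation of $U(B)$ generated by a highest weight vector $\Psi$, that is, $V_B=U(B)\Psi$ with $\Psi\neq0$ and there are $d_k\in\mathbb{C}$ such that $x_k^{+}\Psi=0$ and $h_k\Psi=d_k\Psi$ for all $k\ge0$. Suppose that $x_1^{-}$ is nilpotent of degree $r\geq 0$ in $V_B$, that is, $(x_1^{-})^{r+1}\Psi=0$ while $(x_1^{-})^{j}\Psi\ne0$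 for $0<j\le r$. For $k\ge0$ let $\lambda_k\in\mathbb{C}$ be the eigenvalue given by $$\frac{(x_0^{+})^{k}}{k!}\,\frac{(x_1^{-})^{k}}{k!}\,\Psi=\lambda_k\Psi$$ ($\Psi$ is always an eigenvector of this operator), and let $P_\Psi(u)=\sum_{k=0}^{r}\lambda_k(-u)^k$ be the generalized Drinfeld polynomial of $\Psi$. Suppose that $\Psi$ has distinct and nonzero evaluation parameters $a_1,\dots,a_r\in\mathbb{C}$, that is, $$P_\Psi(u)=\prod_{j=1}^{r}(1-a_ju)$$ with $a_1,\dots,a_r$ pairwise distinct and all nonzero. Then $V_B$ is irreducible. -/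

import Mathlib

open scoped TensorProduct

namespace SlTwoLoop

/-- The `sl₂` loop algebra `ℂ[t, t⁻¹] ⊗ sl₂(ℂ)`. -/
abbrev Loop : Type :=
  LieAlgebra.loopAlgebra ℂ ℤ (LieAlgebra.SpecialLinear.sl (Fin 2) ℂ)

/-- The universal enveloping algebra `U(L(sl₂))`. -/
abbrev ULoop : Type := UniversalEnvelopingAlgebra ℂ Loop

/-- The loop algebra element `t ^ k ⊗ E₁₂`. -/
noncomputable def loopXPlus (k : ℤ) : Loop :=
  (LaurentPolynomial.T k : LaurentPolynomial ℂ) ⊗ₜ[ℂ]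
    LieAlgebra.SpecialLinear.single (0 : Fin 2) 1 (by decide) (1 : ℂ)

/-- The loop algebra element `t ^ k ⊗ E₂₁`. -/
noncomputable def loopXMinus (k : ℤ) : Loop :=
  (LaurentPolynomial.T k : LaurentPolynomial ℂ) ⊗ₜ[ℂ]
    LieAlgebra.SpecialLinear.single (1 : Fin 2) 0 (by decide) (1 : ℂ)

/-- The loop algebra element `t ^ k ⊗ (E₁₁ - E₂₂)`. -/
noncomputable def loopH (k : ℤ) : Loop :=
  (LaurentPolynomial.T k : LaurentPolynomial ℂ) ⊗ₜ[ℂ]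
    LieAlgebra.SpecialLinear.singleSubSingle (0 : Fin 2) 1 (1 : ℂ)

/-! The defining relations of the Drinfeld generators hold in the loop algebra. -/

theorem loop_lie_tmul (j k : ℤ) (a b : LieAlgebra.SpecialLinear.sl (Fin 2) ℂ) :
    ⁅((LaurentPolynomial.T j : LaurentPolynomial ℂ) ⊗ₜ[ℂ] a : Loop),
      ((LaurentPolynomial.T k : LaurentPolynomial ℂ) ⊗ₜ[ℂ] b : Loop)⁆ =
      (LaurentPolynomial.T (j + k) : LaurentPolynomial ℂ) ⊗ₜ[ℂ] ⁅a, b⁆ := by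
  rw [LaurentPolynomial.T_add]
  exact LieAlgebra.ExtendScalars.bracket_tmul ℂ _ _ _ _ _ _ _

theorem lie_loopXPlus_loopXMinus (j k : ℤ) :
    ⁅loopXPlus j, loopXMinus k⁆ = loopH (j + k) := by
  rw [loopXPlus, loopXMinus, loop_lie_tmul, loopH]
  congr 1
  apply Subtype.ext
  rw [LieAlgebra.SpecialLinear.sl_bracket]
  ext a b
  fin_cases a <;> fin_cases b <;> simp [Matrix.mul_apply, Matrix.single]

theorem lie_loopH_loopXPlus (j k : ℤ) :
    ⁅loopH j, loopXPlus k⁆ = (2 : ℂ) • loopXPlus (j + k) := by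
  rw [loopXPlus, loopH, loop_lie_tmul, loopXPlus, ← TensorProduct.tmul_smul]
  congr 1
  apply Subtype.ext
  rw [LieAlgebra.SpecialLinear.sl_bracket]
  ext a b
  fin_cases a <;> fin_cases b <;> simp [Matrix.mul_apply, Matrix.single]
  norm_num

theorem lie_loopH_loopXMinus (j k : ℤ) :
    ⁅loopH j, loopXMinus k⁆ = (-2 : ℂ) • loopXMinus (j + k) := by
  rw [loopXMinus, loopH, loop_lie_tmul, loopXMinus, ← TensorProduct.tmul_smul]
  congr 1
  apply Subtype.ext
  rw [LieAlgebra.SpecialLinear.sl_bracket]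
  ext a b
  fin_cases a <;> fin_cases b <;> simp [Matrix.mul_apply, Matrix.single]
  norm_num

theorem lie_loopH_loopH (j k : ℤ) : ⁅loopH j, loopH k⁆ = 0 := by
  rw [loopH, loopH, loop_lie_tmul, lie_self, TensorProduct.tmul_zero]

theorem lie_loopXPlus_loopXPlus (j k : ℤ) : ⁅loopXPlus j, loopXPlus k⁆ = 0 := by
  rw [loopXPlus, loopXPlus, loop_lie_tmul, lie_self, TensorProduct.tmul_zero]

theorem lie_loopXMinus_loopXMinus (j k : ℤ) : ⁅loopXMinus j, loopXMinus k⁆ = 0 := by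
  rw [loopXMinus, loopXMinus, loop_lie_tmul, lie_self, TensorProduct.tmul_zero]

/-- The canonical map `L(sl₂) → U(L(sl₂))`. -/
noncomputable abbrev toULoop (x : Loop) : ULoop := UniversalEnvelopingAlgebra.ι ℂ x

theorem toULoop_mul_sub (x y : Loop) :
    toULoop x * toULoop y - toULoop y * toULoop x = toULoop ⁅x, y⁆ := by
  let _ : LieRing ULoop := LieRing.ofAssociativeRing
  exact ((UniversalEnvelopingAlgebra.ι ℂ).map_lie x y).symm

theorem toULoop_smul (c : ℂ) (x : Loop) : toULoop (c • x) = c • toULoop x := by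
  let _ : LieRing ULoop := LieRing.ofAssociativeRing
  exact (UniversalEnvelopingAlgebra.ι ℂ : Loop →ₗ⁅ℂ⁆ ULoop).toLinearMap.map_smul c x

/-- The Borel subalgebra `U(B)` of `U(L(sl₂))`: the unital subalgebra generated by
`h₀`, `x₀⁺` and `x₁⁻`. -/
noncomputable def borel : Subalgebra ℂ ULoop :=
  Algebra.adjoin ℂ {toULoop (loopH 0), toULoop (loopXPlus 0), toULoop (loopXMinus 1)}

theorem lie_mem_borel {x y : Loop} (hx : toULoop x ∈ borel) (hy : toULoop y ∈ borel) :
    toULoop ⁅x, y⁆ ∈ borel := by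
  rw [← toULoop_mul_sub]
  exact sub_mem (mul_mem hx hy) (mul_mem hy hx)

theorem mem_borel_of_smul {c : ℂ} (hc : c ≠ 0) {x : Loop} (h : toULoop (c • x) ∈ borel) :
    toULoop x ∈ borel := by
  have h2 := borel.smul_mem h c⁻¹
  rwa [toULoop_smul, smul_smul, inv_mul_cancel₀ hc, one_smul] at h2

theorem loopXPlus_zero_mem : toULoop (loopXPlus 0) ∈ borel :=
  Algebra.subset_adjoin (by simp)

theorem loopXMinus_one_mem : toULoop (loopXMinus 1) ∈ borel :=
  Algebra.subset_adjoin (by simp)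

theorem loopH_one_mem : toULoop (loopH 1) ∈ borel := by
  have h := lie_mem_borel loopXPlus_zero_mem loopXMinus_one_mem
  rwa [lie_loopXPlus_loopXMinus] at h

theorem loopXPlus_mem (k : ℕ) : toULoop (loopXPlus k) ∈ borel := by
  induction k with
  | zero => exact loopXPlus_zero_mem
  | succ k ih =>
    have h := lie_mem_borel loopH_one_mem ih
    rw [lie_loopH_loopXPlus] at h
    have h2 := mem_borel_of_smul (by norm_num) h
    rwa [show ((k + 1 : ℕ) : ℤ) = 1 + (k : ℤ) by push_cast; ring]

theorem loopXMinus_mem (k : ℕ) : toULoop (loopXMinus (k + 1)) ∈ borel := by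
  induction k with
  | zero => simpa using loopXMinus_one_mem
  | succ k ih =>
    have h := lie_mem_borel loopH_one_mem ih
    rw [lie_loopH_loopXMinus] at h
    have h2 := mem_borel_of_smul (by norm_num) h
    rwa [show ((k + 1 : ℕ) : ℤ) + 1 = 1 + ((k : ℤ) + 1) by push_cast; ring]

theorem loopH_mem (k : ℕ) : toULoop (loopH k) ∈ borel := by
  cases k with
  | zero => exact Algebra.subset_adjoin (by simp)
  | succ k =>
    have h := lie_mem_borel loopXPlus_zero_mem (loopXMinus_mem k)
    rw [lie_loopXPlus_loopXMinus, zero_add] at h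
    exact_mod_cast h

/-- The generator `x_k⁺` of `U(B)`, `k ≥ 0`. -/
noncomputable def xPlus (k : ℕ) : borel := ⟨toULoop (loopXPlus k), loopXPlus_mem k⟩

/-- The generator `h_k` of `U(B)`, `k ≥ 0`. -/
noncomputable def h (k : ℕ) : borel := ⟨toULoop (loopH k), loopH_mem k⟩

/-- The generator `x_k⁻` of `U(B)`, `k > 0`. -/
noncomputable def xMinus (k : ℕ) (hk : 0 < k) : borel :=
  ⟨toULoop (loopXMinus k), by
    obtain ⟨m, rfl⟩ := Nat.exists_eq_succ_of_ne_zero hk.ne'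
    exact_mod_cast loopXMinus_mem m⟩

theorem xPlus_mul_xMinus (j k : ℕ) (hk : 0 < k) :
    xPlus j * xMinus k hk = xMinus k hk * xPlus j + h (j + k) := by
  apply Subtype.ext
  have e := toULoop_mul_sub (loopXPlus j) (loopXMinus k)
  rw [lie_loopXPlus_loopXMinus, sub_eq_iff_eq_add'] at e
  simpa [xPlus, xMinus, h] using e

theorem h_mul_xMinus (j k : ℕ) (hk : 0 < k) :
    h j * xMinus k hk = xMinus k hk * h j + (-2 : ℂ) • xMinus (j + k) (by omega) := by
  apply Subtype.ext
  have e := toULoop_mul_sub (loopH j) (loopXMinus k)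
  rw [lie_loopH_loopXMinus, sub_eq_iff_eq_add', toULoop_smul] at e
  simpa [xMinus, h] using e

/-- The divided power `X ^ n / n!`. -/
noncomputable def divPow (X : borel) (n : ℕ) : borel := ((n.factorial : ℂ)⁻¹) • X ^ n

section Representation

variable {V : Type*} [AddCommGroup V] [Module ℂ V] [Module borel V] [IsScalarTower ℂ borel V]

/-- `Ψ` is a highest weight vector of `U(B)` with highest weight `d`. -/
structure IsHighestWeightVector (Ψ : V) (d : ℕ → ℂ) : Prop where
  ne_zero : Ψ ≠ 0
  xPlus_smul : ∀ k, xPlus k • Ψ = 0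
  h_smul : ∀ k, h k • Ψ = d k • Ψ

/-- `x₁⁻` is nilpotent of degree `r` (with respect to `Ψ`). -/
def NilpotentOfDegree (Ψ : V) (r : ℕ) : Prop :=
  xMinus 1 one_pos ^ (r + 1) • Ψ = 0 ∧ ∀ j, 0 < j → j ≤ r → xMinus 1 one_pos ^ j • Ψ ≠ 0

/-- The eigenvalue `λ_k` of `(x₀⁺)^(k) (x₁⁻)^(k)` on `Ψ`. For a highest weight vector it exists
and is unique, see `IsHighestWeightVector.lam_eq_iff`. -/
noncomputable def lam (Ψ : V) (k : ℕ) : ℂ :=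
  Classical.epsilon fun c : ℂ => (divPow (xPlus 0) k * divPow (xMinus 1 one_pos) k) • Ψ = c • Ψ

/-- The span of the vectors `x⁻_{k₁} ⋯ x⁻_{kₙ} Ψ` with `k₁, …, kₙ > 0`. -/
def sector (Ψ : V) : ℕ → Submodule ℂ V
  | 0 => Submodule.span ℂ {Ψ}
  | n + 1 => Submodule.span ℂ
      {v | ∃ (k : ℕ) (hk : 0 < k), ∃ w ∈ sector Ψ n, v = xMinus k hk • w}

theorem smul_comm_complex (b : borel) (c : ℂ) (v : V) : b • c • v = c • b • v := by
  rw [← smul_one_smul borel c v, smul_smul, ← smul_assoc c b v]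
  congr 1
  simp

theorem smul_mem_of_span (b : borel) {S : Set V} {W : Submodule ℂ V}
    (hS : ∀ v ∈ S, b • v ∈ W) {v : V} (hv : v ∈ Submodule.span ℂ S) : b • v ∈ W := by
  induction hv using Submodule.span_induction with
  | mem x hx => exact hS x hx
  | zero => rw [smul_zero]; exact W.zero_mem
  | add x y _ _ hx hy => rw [smul_add]; exact W.add_mem hx hy
  | smul c x _ hx => rw [smul_comm_complex]; exact W.smul_mem c hx

theorem xMinus_smul_mem_sector (Ψ : V) (n k : ℕ) (hk : 0 < k) {v : V} (hv : v ∈ sector Ψ n) :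
    xMinus k hk • v ∈ sector Ψ (n + 1) :=
  Submodule.subset_span ⟨k, hk, v, hv, rfl⟩

namespace IsHighestWeightVector

variable {Ψ : V} {d : ℕ → ℂ}

theorem h_smul_mem_sector (hΨ : IsHighestWeightVector Ψ d) (n : ℕ) :
    ∀ (j : ℕ) {v : V}, v ∈ sector Ψ n → h j • v ∈ sector Ψ n := by
  induction n with
  | zero =>
    intro j v hv
    refine smul_mem_of_span (h j) ?_ hv
    rintro _ rfl
    rw [hΨ.h_smul]
    exact Submodule.smul_mem _ _ (Submodule.mem_span_singleton_self _)
  | succ n ih =>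
    intro j v hv
    refine smul_mem_of_span (h j) ?_ hv
    rintro _ ⟨k, hk, w, hw, rfl⟩
    rw [← mul_smul, h_mul_xMinus, add_smul, mul_smul, smul_assoc]
    exact add_mem (xMinus_smul_mem_sector Ψ n k hk (ih j hw))
      (Submodule.smul_mem _ _ (xMinus_smul_mem_sector Ψ n _ _ hw))

theorem xPlus_smul_mem_sector (hΨ : IsHighestWeightVector Ψ d) (n : ℕ) :
    ∀ (j : ℕ) {v : V}, v ∈ sector Ψ (n + 1) → xPlus j • v ∈ sector Ψ n := by
  induction n with
  | zero =>
    intro j v hv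
    refine smul_mem_of_span (xPlus j) ?_ hv
    rintro _ ⟨k, hk, w, hw, rfl⟩
    rw [← mul_smul, xPlus_mul_xMinus, add_smul, mul_smul]
    have h0 : xPlus j • w = 0 := by
      have := smul_mem_of_span (xPlus j) (W := ⊥) (S := {Ψ})
        (by rintro _ rfl; simp [hΨ.xPlus_smul]) hw
      simpa using this
    rw [h0, smul_zero, zero_add]
    exact hΨ.h_smul_mem_sector 0 _ hw
  | succ n ih =>
    intro j v hv
    refine smul_mem_of_span (xPlus j) ?_ hv
    rintro _ ⟨k, hk, w, hw, rfl⟩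
    rw [← mul_smul, xPlus_mul_xMinus, add_smul, mul_smul]
    exact add_mem (xMinus_smul_mem_sector Ψ n k hk (ih j hw)) (hΨ.h_smul_mem_sector (n + 1) _ hw)

theorem xMinus_pow_smul_mem (Ψ : V) (k : ℕ) : xMinus 1 one_pos ^ k • Ψ ∈ sector Ψ k := by
  induction k with
  | zero =>
    rw [pow_zero, one_smul]
    exact Submodule.mem_span_singleton_self Ψ
  | succ k ih =>
    rw [pow_succ', mul_smul]
    exact xMinus_smul_mem_sector Ψ k 1 one_pos ih

theorem xPlus_pow_smul_mem (hΨ : IsHighestWeightVector Ψ d) (k n : ℕ) :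
    ∀ {v : V}, v ∈ sector Ψ (n + k) → xPlus 0 ^ k • v ∈ sector Ψ n := by
  induction k with
  | zero => intro v hv; simpa using hv
  | succ k ih =>
    intro v hv
    rw [pow_succ, mul_smul]
    exact ih (hΨ.xPlus_smul_mem_sector (n + k) 0 hv)

/-- `Ψ` is an eigenvector of `(x₀⁺)^(k) (x₁⁻)^(k)`, with eigenvalue `λ_k`. -/
theorem lam_spec (hΨ : IsHighestWeightVector Ψ d) (k : ℕ) :
    (divPow (xPlus 0) k * divPow (xMinus 1 one_pos) k) • Ψ = lam Ψ k • Ψ := by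
  refine Classical.epsilon_spec
    (p := fun c : ℂ => (divPow (xPlus 0) k * divPow (xMinus 1 one_pos) k) • Ψ = c • Ψ) ?_
  have h1 : xPlus 0 ^ k • xMinus 1 one_pos ^ k • Ψ ∈ sector Ψ 0 :=
    hΨ.xPlus_pow_smul_mem k 0 (by simpa using xMinus_pow_smul_mem Ψ k)
  obtain ⟨c, hc⟩ := Submodule.mem_span_singleton.mp h1
  refine ⟨(k.factorial : ℂ)⁻¹ * ((k.factorial : ℂ)⁻¹ * c), ?_⟩
  rw [divPow, divPow, mul_smul, smul_assoc, smul_assoc, smul_comm_complex, ← hc, smul_smul,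
    smul_smul, mul_assoc]

theorem lam_eq_iff (hΨ : IsHighestWeightVector Ψ d) (k : ℕ) (c : ℂ) :
    lam Ψ k = c ↔ (divPow (xPlus 0) k * divPow (xMinus 1 one_pos) k) • Ψ = c • Ψ := by
  rw [hΨ.lam_spec k]
  exact ⟨fun e => by rw [e], fun e => smul_left_injective ℂ hΨ.ne_zero e⟩

end IsHighestWeightVector

/-- The generalized Drinfeld polynomial `P_Ψ(u) = ∑_{k=0}^{r} λ_k (-u)^k`. -/
noncomputable def drinfeldPoly (Ψ : V) (r : ℕ) : Polynomial ℂ :=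
  ∑ k ∈ Finset.range (r + 1), Polynomial.C (lam Ψ k) * (-Polynomial.X) ^ k

/-- `a₁, …, a_r` are the evaluation parameters of `Ψ`, listed with multiplicity:
`P_Ψ(u) = ∏_{i=1}^{r} (1 - a_i u)`. -/
def HasEvaluationParameters (Ψ : V) (r : ℕ) (a : Fin r → ℂ) : Prop :=
  drinfeldPoly Ψ r = ∏ i, (1 - Polynomial.C (a i) * Polynomial.X)

end Representation

end SlTwoLoop

/-! Write x⁻(f) for the image of f(t) ⊗ E₂₁, and similarly x⁺(f), h(f). Commuting x₀⁺ past x₁⁻ gives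
a Garland-type identity: (x₀⁺)^(n) (x₁⁻)^(n+1) Ψ = x⁻(t gₙ) Ψ with gₙ₊₁ = λₙ₊₁ - t gₙ
(`raise_lower_succ`). For n = r the left side vanishes by nilpotency, while g_r = ±∏ (t - aᵢ). Since
the lowering operators commute and generate V from Ψ, x⁻(t g_r) vanishes on all of V, and brackets
with h(g) turn this into vanishing on the ideal generated by g_r. As the aᵢ are distinct, x⁻(t f)
depends only on the values f(aᵢ) (`xm_eq_zero_of_eval`), and brackets carry this over to h(t f) and
x⁺(t f).

One more x₀⁺ applied to the identity gives Newton's identities for the weights, so d_k = ∑ aᵢ^k for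
k ≥ 1 (`eq_sum_eval_of_newton`). Lagrange interpolation, which needs aᵢ ≠ 0 because of the factor t,
yields r mutually commuting sl₂-triples inside U(B), and Ψ has weight 1 for each. By finite
dimension each yᵢ squares to zero (`y_y`), so V is spanned by products of distinct yᵢ applied to Ψ
(`layer_finRange`). Suitable xᵢ then raise any nonzero vector to a nonzero multiple of Ψ
(`mem_of_ne_zero`), and Ψ generates V. -/

namespace SlTwoLoop

open Polynomial

/-- Operators `xp f = x⁺(f)`, `hh f = h(f)` and `xm f = x⁻(t f)` for polynomials `f` in the loop
parameter `t`, satisfying the commutation relations of the Borel subalgebra. -/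
structure BorelOperators (V : Type*) [AddCommGroup V] [Module ℂ V] where
  xp : ℂ[X] →ₗ[ℂ] Module.End ℂ V
  hh : ℂ[X] →ₗ[ℂ] Module.End ℂ V
  xm : ℂ[X] →ₗ[ℂ] Module.End ℂ V
  xp_mul_xm : ∀ f g, xp f * xm g = xm g * xp f + hh (X * (f * g))
  hh_mul_xm : ∀ f g, hh f * xm g = xm g * hh f + (-2 : ℂ) • xm (f * g)
  hh_mul_xp : ∀ f g, hh f * xp g = xp g * hh f + (2 : ℂ) • xp (f * g)
  xm_mul_xm : ∀ f g, xm f * xm g = xm g * xm f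
  xp_mul_xp : ∀ f g, xp f * xp g = xp g * xp f

/-! ### Commutation of divided powers with the generators. -/

namespace BorelOperators

variable {V : Type*} [AddCommGroup V] [Module ℂ V] (T : BorelOperators V)

/-- `Ψ` is a highest weight vector, with weight functional `D`, that generates `V` under the
lowering operators. -/
structure IsCyclicHighestWeight (Ψ : V) (D : ℂ[X] →ₗ[ℂ] ℂ) : Prop where
  ne_zero : Ψ ≠ 0
  xp_apply : ∀ f, T.xp f Ψ = 0
  hh_apply : ∀ f, T.hh f Ψ = D f • Ψ
  eq_top : ∀ N : Submodule ℂ V, Ψ ∈ N → (∀ f, ∀ v ∈ N, T.xm f v ∈ N) → N = ⊤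

theorem xp_xm_apply (f g : ℂ[X]) (v : V) :
    T.xp f (T.xm g v) = T.xm g (T.xp f v) + T.hh (X * (f * g)) v :=
  LinearMap.congr_fun (T.xp_mul_xm f g) v

theorem hh_xm_apply (f g : ℂ[X]) (v : V) :
    T.hh f (T.xm g v) = T.xm g (T.hh f v) + (-2 : ℂ) • T.xm (f * g) v :=
  LinearMap.congr_fun (T.hh_mul_xm f g) v

theorem xm_xm_apply (f g : ℂ[X]) (v : V) : T.xm f (T.xm g v) = T.xm g (T.xm f v) :=
  LinearMap.congr_fun (T.xm_mul_xm f g) v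

/-- The divided power `(x₀⁺)^(n)`. -/
noncomputable def raise (n : ℕ) : Module.End ℂ V := ((n.factorial : ℂ)⁻¹) • T.xp 1 ^ n

/-- The divided power `(x₁⁻)^(n)`. -/
noncomputable def lower (n : ℕ) : Module.End ℂ V := ((n.factorial : ℂ)⁻¹) • T.xm 1 ^ n

theorem inv_factorial_succ (n : ℕ) :
    (n.factorial : ℂ)⁻¹ = ((n : ℂ) + 1) * (((n + 1).factorial : ℂ)⁻¹) := by
  have h1 : (n.factorial : ℂ) ≠ 0 := by exact_mod_cast n.factorial_ne_zero
  have h2 : (n : ℂ) + 1 ≠ 0 := by exact_mod_cast n.succ_ne_zero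
  rw [Nat.factorial_succ]
  push_cast
  field_simp

theorem xp_one_mul_raise (n : ℕ) : T.xp 1 * T.raise n = ((n : ℂ) + 1) • T.raise (n + 1) := by
  rw [raise, raise, mul_smul_comm, ← pow_succ', smul_smul, inv_factorial_succ]

theorem raise_mul_xp_one (n : ℕ) : T.raise n * T.xp 1 = ((n : ℂ) + 1) • T.raise (n + 1) := by
  rw [raise, raise, smul_mul_assoc, ← pow_succ, smul_smul, inv_factorial_succ]

theorem xm_one_mul_lower (n : ℕ) : T.xm 1 * T.lower n = ((n : ℂ) + 1) • T.lower (n + 1) := by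
  rw [lower, lower, mul_smul_comm, ← pow_succ', smul_smul, inv_factorial_succ]

@[simp] theorem raise_zero : T.raise 0 = 1 := by simp [raise]

@[simp] theorem lower_zero : T.lower 0 = 1 := by simp [lower]

theorem lower_one : T.lower 1 = T.xm 1 := by simp [lower]

theorem raise_one : T.raise 1 = T.xp 1 := by simp [raise]

theorem raise_succ_mul_hh (n : ℕ) :
    T.raise (n + 1) * T.hh X = T.hh X * T.raise (n + 1) - (2 : ℂ) • (T.raise n * T.xp X) := by
  induction n with
  | zero =>
    have := T.hh_mul_xp X 1
    rw [mul_one] at this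
    simp [raise_one, this]
  | succ n ih =>
    have hn : ((n + 1 : ℕ) : ℂ) + 1 ≠ 0 := by exact_mod_cast (n + 1).succ_ne_zero
    have h1 := T.hh_mul_xp X 1
    rw [mul_one] at h1
    have h2 : T.xp 1 * T.raise n * T.xp X = ((n : ℂ) + 1) • (T.raise (n + 1) * T.xp X) := by
      rw [xp_one_mul_raise, smul_mul_assoc]
    have h3 : T.xp X * T.raise (n + 1) = T.raise (n + 1) * T.xp X := by
      rw [raise, mul_smul_comm, smul_mul_assoc]
      congr 1
      exact (Commute.pow_right (T.xp_mul_xp X 1) (n + 1)).eq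
    apply smul_right_injective _ hn
    simp only
    rw [smul_sub, ← smul_mul_assoc, ← mul_smul_comm, ← xp_one_mul_raise, mul_assoc, ih, mul_sub,
      ← mul_assoc, ← mul_assoc, h1, mul_smul_comm, ← mul_assoc, h2, add_mul, smul_mul_assoc, h3]
    push_cast
    module

/-- Moving x₁⁻ through n + 1 factors x₀⁺ leaves h₁ in each of n + 1 positions. Since [h₁, x₀⁺] = 2
x₁⁺ commutes with x₀⁺, these terms form an arithmetic progression, so their average is that of the
two extreme positions. -/
theorem raise_succ_mul_xm_one (n : ℕ) :
    T.raise (n + 1) * T.xm 1 = T.xm 1 * T.raise (n + 1) +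
      (2⁻¹ : ℂ) • (T.hh X * T.raise n + T.raise n * T.hh X) := by
  have h0 := T.xp_mul_xm 1 1
  rw [mul_one, mul_one] at h0
  have h1 := T.hh_mul_xp X 1
  rw [mul_one] at h1
  induction n with
  | zero =>
    rw [zero_add, raise_one, h0]
    simp only [raise_zero, mul_one, one_mul]
    module
  | succ n ih =>
    have hn : ((n + 1 : ℕ) : ℂ) + 1 ≠ 0 := by exact_mod_cast (n + 1).succ_ne_zero
    have h4 := T.raise_succ_mul_hh n
    -- Scaling by n + 2 turns `raise (n + 2)` into `raise (n + 1) * xp 1`, to which the induction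
    -- hypothesis applies.
    apply smul_right_injective _ hn
    simp only
    have h5 : T.raise (n + 1) * T.xp 1 * T.xm 1 = T.xm 1 * (T.raise (n + 1) * T.xp 1) +
      (2⁻¹ : ℂ) • (T.hh X * (T.raise n * T.xp 1) + T.raise n * T.xp 1 * T.hh X +
        (2 : ℂ) • (T.raise n * T.xp X)) + T.raise (n + 1) * T.hh X := by
      rw [mul_assoc, h0, mul_add, ← mul_assoc, ih, add_mul, smul_mul_assoc, add_mul]
      simp only [mul_assoc, h1, mul_add, mul_smul_comm]
      module
    rw [raise_mul_xp_one, raise_mul_xp_one] at h5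
    simp only [smul_mul_assoc, mul_smul_comm] at h5
    rw [h5]
    have h6 : (2 : ℂ) • (T.raise n * T.xp X) =
        T.hh X * T.raise (n + 1) - T.raise (n + 1) * T.hh X := by
      rw [h4]; abel
    rw [h6]
    push_cast
    module

end BorelOperators

/-! ### The Garland-type identity and the weights of Ψ. -/

namespace BorelOperators

variable {V : Type*} [AddCommGroup V] [Module ℂ V] (T : BorelOperators V)

/-- The polynomials `f` with `(x₀⁺)^(n) (x₁⁻)^(n+1) Ψ = x⁻(t f) Ψ`. -/
noncomputable def garlandPoly (l : ℕ → ℂ) : ℕ → ℂ[X]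
  | 0 => C (l 0)
  | n + 1 => C (l (n + 1)) - X * garlandPoly l n

theorem garlandPoly_eq_sum (l : ℕ → ℂ) (n : ℕ) :
    garlandPoly l n = ∑ k ∈ Finset.range (n + 1), C ((-1) ^ k * l (n - k)) * X ^ k := by
  induction n with
  | zero => simp [garlandPoly]
  | succ n ih =>
    rw [garlandPoly, ih, Finset.sum_range_succ' _ (n + 1), Finset.mul_sum, sub_eq_add_neg,
      ← Finset.sum_neg_distrib, add_comm (C _)]
    congr 1
    · refine Finset.sum_congr rfl fun k _ => ?_
      rw [Nat.add_sub_add_right, pow_succ, pow_succ]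
      simp only [map_mul, map_neg, map_pow, map_one]
      ring
    · simp

namespace IsCyclicHighestWeight

variable {T} {Ψ : V} {D : ℂ[X] →ₗ[ℂ] ℂ}

theorem hh_lower_succ (hΨ : T.IsCyclicHighestWeight Ψ D) (n : ℕ) :
    T.hh X (T.lower (n + 1) Ψ) =
      D X • T.lower (n + 1) Ψ + (-2 : ℂ) • T.xm X (T.lower n Ψ) := by
  induction n with
  | zero => simp [lower_one, hh_xm_apply, hΨ.hh_apply]
  | succ n ih =>
    have hn : ((n + 1 : ℕ) : ℂ) + 1 ≠ 0 := by exact_mod_cast (n + 1).succ_ne_zero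
    have e1 := LinearMap.congr_fun (T.xm_one_mul_lower (n + 1)) Ψ
    have e2 := LinearMap.congr_fun (T.xm_one_mul_lower n) Ψ
    simp only [Module.End.mul_apply, LinearMap.smul_apply] at e1 e2
    apply smul_right_injective _ hn
    simp only
    rw [← map_smul, ← e1, hh_xm_apply, ih, map_add, map_smul, map_smul, xm_xm_apply, e1, e2,
      mul_one, map_smul]
    push_cast
    module

/-- The same averaging with raising and lowering exchanged; the h₁ in the rightmost position acts on
Ψ by the scalar `D X`. -/
theorem xp_one_lower_succ (hΨ : T.IsCyclicHighestWeight Ψ D) (n : ℕ) :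
    T.xp 1 (T.lower (n + 1) Ψ) =
      (2⁻¹ : ℂ) • (T.hh X (T.lower n Ψ) + D X • T.lower n Ψ) := by
  induction n with
  | zero =>
    simp only [zero_add, lower_one, lower_zero, Module.End.one_apply, xp_xm_apply, hΨ.hh_apply,
      hΨ.xp_apply, map_zero, mul_one]
    module
  | succ n ih =>
    have hn : ((n + 1 : ℕ) : ℂ) + 1 ≠ 0 := by exact_mod_cast (n + 1).succ_ne_zero
    have e1 := LinearMap.congr_fun (T.xm_one_mul_lower (n + 1)) Ψ
    have e2 := LinearMap.congr_fun (T.xm_one_mul_lower n) Ψ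
    have e3 := T.hh_xm_apply X 1 (T.lower n Ψ)
    have e4 := hΨ.hh_lower_succ n
    simp only [Module.End.mul_apply, LinearMap.smul_apply] at e1 e2
    rw [e2, mul_one, map_smul] at e3
    apply smul_right_injective _ hn
    simp only
    rw [← map_smul, ← e1, xp_xm_apply, ih, map_smul, map_add, map_smul, mul_one, mul_one, e2,
      ← sub_eq_iff_eq_add.mpr e3, e4]
    push_cast
    module

theorem hh_X_xm (hΨ : T.IsCyclicHighestWeight Ψ D) (f : ℂ[X]) :
    T.hh X (T.xm f Ψ) = D X • T.xm f Ψ + (-2 : ℂ) • T.xm (X * f) Ψ := by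
  rw [hh_xm_apply, hΨ.hh_apply, map_smul]

/-- The left side at n + 1 is computed twice: with factor n + 2 by extracting one x₁⁻, and with
factor n + 1 by extracting one x₀⁺. In the difference the term with h₁ between raising and lowering
operators cancels, and the remaining (h₁ - `D X`)/2 acts on x⁻(t f) Ψ as multiplication of f by -t.
-/
theorem raise_lower_succ (hΨ : T.IsCyclicHighestWeight Ψ D) {l : ℕ → ℂ}
    (hl : ∀ n, T.raise n (T.lower n Ψ) = l n • Ψ) (n : ℕ) :
    T.raise n (T.lower (n + 1) Ψ) = T.xm (garlandPoly l n) Ψ := by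
  induction n with
  | zero =>
    have := hl 0
    simp only [raise_zero, lower_zero, Module.End.one_apply] at this
    simp only [raise_zero, zero_add, lower_one, Module.End.one_apply, garlandPoly]
    rw [← mul_one (C (l 0)), ← smul_eq_C_mul, map_smul, LinearMap.smul_apply, ← map_smul, ← this]
  | succ n ih =>
    have e1 := LinearMap.congr_fun (T.xm_one_mul_lower (n + 1)) Ψ
    have e2 := LinearMap.congr_fun (T.raise_mul_xp_one n) (T.lower (n + 1 + 1) Ψ)
    have e3 := LinearMap.congr_fun (T.raise_succ_mul_xm_one n) (T.lower (n + 1) Ψ)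
    simp only [Module.End.mul_apply, LinearMap.smul_apply, LinearMap.add_apply] at e1 e2 e3
    rw [hΨ.xp_one_lower_succ, map_smul, map_add, map_smul, ih] at e2
    rw [e1, map_smul, hl, ih, map_smul, hΨ.hh_X_xm] at e3
    have e4 : T.xm (garlandPoly l (n + 1)) Ψ =
        l (n + 1) • T.xm 1 Ψ - T.xm (X * garlandPoly l n) Ψ := by
      rw [garlandPoly, map_sub, LinearMap.sub_apply, ← mul_one (C (l (n + 1))), ← smul_eq_C_mul,
        map_smul, LinearMap.smul_apply]
    rw [e4]
    push_cast at e3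
    linear_combination (norm := module) e3 + e2

/-- Obtained by applying x₀⁺ once more to `raise_lower_succ`. With `l` elementary symmetric, this is
Newton's identity. -/
theorem weight_garlandPoly (hΨ : T.IsCyclicHighestWeight Ψ D) {l : ℕ → ℂ}
    (hl : ∀ n, T.raise n (T.lower n Ψ) = l n • Ψ) (n : ℕ) :
    D (X * garlandPoly l n) = ((n : ℂ) + 1) * l (n + 1) := by
  have e1 := LinearMap.congr_fun (T.xp_one_mul_raise n) (T.lower (n + 1) Ψ)
  simp only [Module.End.mul_apply, LinearMap.smul_apply] at e1
  rw [hl, hΨ.raise_lower_succ hl, xp_xm_apply, hΨ.xp_apply, map_zero, zero_add, hΨ.hh_apply,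
    one_mul, smul_smul] at e1
  exact smul_left_injective ℂ hΨ.ne_zero e1

end IsCyclicHighestWeight

end BorelOperators

/-! ### Symmetric functions of the evaluation parameters. -/

/-- The coefficients of `∏ (1 - aᵢ u)` are the signed elementary symmetric functions. -/
theorem prod_one_sub_C_mul_X {r : ℕ} (a : Fin r → ℂ) :
    ∏ i, (1 - C (a i) * X) = ∑ k ∈ Finset.range (r + 1),
      C (MvPolynomial.aeval a (MvPolynomial.esymm (Fin r) ℂ k)) * (-X) ^ k := by
  simp_rw [sub_eq_add_neg]
  rw [Finset.prod_one_add, Finset.sum_powerset, Finset.card_univ, Fintype.card_fin]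
  refine Finset.sum_congr rfl fun k _ => ?_
  rw [MvPolynomial.esymm, map_sum, map_sum, Finset.sum_mul]
  refine Finset.sum_congr rfl fun t ht => ?_
  rw [map_prod, map_prod, ← (Finset.mem_powersetCard.mp ht).2, ← Finset.prod_const,
    ← Finset.prod_mul_distrib]
  refine Finset.prod_congr rfl fun i _ => ?_
  simp

theorem coeff_sum_C_mul_neg_X_pow (c : ℕ → ℂ) (m n : ℕ) (hn : n < m) :
    (∑ k ∈ Finset.range m, C (c k) * (-X : ℂ[X]) ^ k).coeff n = (-1) ^ n * c n := by
  have : ∀ k, C (c k) * (-X : ℂ[X]) ^ k = C ((-1) ^ k * c k) * X ^ k := fun k => by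
    rw [neg_pow]
    simp only [map_mul, map_pow, map_neg, map_one]
    ring
  simp_rw [this, finsetSum_coeff, coeff_C_mul_X_pow]
  rw [Finset.sum_ite_eq, if_pos (Finset.mem_range.mpr hn)]

/-- The recursion `garlandPoly` with elementary symmetric functions reproduces, up to sign, the
polynomial with the given roots. -/
theorem garlandPoly_eq_prod {r : ℕ} (a : Fin r → ℂ) (l : ℕ → ℂ)
    (hl : ∀ k, l k = MvPolynomial.aeval a (MvPolynomial.esymm (Fin r) ℂ k)) :
    ∏ i, (X - C (a i)) = (-1) ^ r * BorelOperators.garlandPoly l r := by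
  have h1 := Multiset.prod_X_sub_X_eq_sum_esymm (Finset.univ.val.map a)
  rw [Multiset.map_map] at h1
  change (Finset.univ.val.map fun i => X - C (a i)).prod = _ at h1
  rw [Finset.prod_eq_multiset_prod, h1, BorelOperators.garlandPoly_eq_sum, Multiset.card_map, Finset.card_val,
    Finset.card_univ, Fintype.card_fin, ← Finset.sum_range_reflect, Finset.mul_sum]
  refine Finset.sum_congr rfl fun k hk => ?_
  have hk : k ≤ r := Nat.lt_succ_iff.mp (Finset.mem_range.mp hk)
  rw [hl, MvPolynomial.aeval_esymm_eq_multiset_esymm, show r + 1 - 1 - k = r - k by omega,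
    show r - (r - k) = k by omega]
  have : (-1 : ℂ[X]) ^ (r - k) = (-1) ^ r * (-1) ^ k := by
    rw [← Nat.sub_add_cancel hk, pow_add, Nat.add_sub_cancel, mul_assoc, ← pow_add,
      (Even.add_self k).neg_one_pow, mul_one]
  rw [this]
  simp only [map_mul, map_pow, map_neg, map_one]
  ring

/-- A functional satisfying Newton's identities is given by power sums. -/
theorem eq_sum_eval_of_newton {r : ℕ} (a : Fin r → ℂ) (l : ℕ → ℂ)
    (hl : ∀ k, l k = MvPolynomial.aeval a (MvPolynomial.esymm (Fin r) ℂ k))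
    (D : ℂ[X] →ₗ[ℂ] ℂ)
    (hD : ∀ n : ℕ, D (X * BorelOperators.garlandPoly l n) = ((n : ℂ) + 1) * l (n + 1))
    (f : ℂ[X]) : D (X * f) = ∑ i, a i * f.eval (a i) := by
  have key : ∀ n, D (X ^ (n + 1)) = ∑ i, a i ^ (n + 1) := by
    intro n
    induction n using Nat.strong_induction_on with
    | _ n ih =>
      have h1 := hD n
      have h2 := congrArg (MvPolynomial.aeval a) (MvPolynomial.mul_esymm_eq_sum (Fin r) ℂ (n + 1))
      have h0 : l 0 = 1 := by simp [hl]
      rw [BorelOperators.garlandPoly_eq_sum, Finset.mul_sum, map_sum] at h1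
      have h3 : ∀ k, D (X * (C ((-1) ^ k * l (n - k)) * X ^ k)) =
          ((-1) ^ k * l (n - k)) * D (X ^ (k + 1)) := fun k => by
        rw [mul_left_comm, ← smul_eq_C_mul, map_smul, ← pow_succ', smul_eq_mul]
      simp_rw [h3] at h1
      have h4 : ((n : ℂ) + 1) * l (n + 1) =
          ∑ k ∈ Finset.range (n + 1), ((-1) ^ k * l (n - k)) * ∑ i, a i ^ (k + 1) := by
        rw [map_mul, ← hl, map_natCast, map_mul, map_sum, Finset.sum_filter,
          Finset.Nat.sum_antidiagonal_eq_sum_range_succ_mk, Finset.sum_range_succ] at h2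
        push_cast at h2
        -- The discarded term is the one containing the zeroth power sum, which Newton's identity
        -- excludes.
        rw [h2, if_neg (lt_irrefl _), add_zero, ← Finset.sum_range_reflect, Finset.mul_sum]
        refine Finset.sum_congr rfl fun k hk => ?_
        have hk : k ≤ n := Nat.lt_succ_iff.mp (Finset.mem_range.mp hk)
        rw [if_pos (by omega)]
        simp only [map_mul, map_pow, map_neg, map_one, ← hl, MvPolynomial.psum, map_sum,
          MvPolynomial.aeval_X]
        rw [show n + 1 - 1 - k = n - k by omega, show n + 1 - (n - k) = k + 1 by omega]
        have : (-1 : ℂ) ^ (n + 1 + 1) * (-1) ^ (n - k) = (-1) ^ k := by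
          obtain ⟨m, rfl⟩ := Nat.exists_eq_add_of_le hk
          rw [Nat.add_sub_cancel_left, ← pow_add,
            show k + m + 1 + 1 + m = k + 2 * (m + 1) by ring, pow_add, pow_mul]
          simp
        rw [← mul_assoc, ← mul_assoc, this]
      -- Lower terms agree by induction. The top term has coefficient (-1)^n `l 0` with `l 0 = 1`,
      -- so it can be cancelled.
      rw [h4, Finset.sum_range_succ, Finset.sum_range_succ, Finset.sum_congr rfl
        fun k hk => by rw [ih k (Finset.mem_range.mp hk)], Nat.sub_self, h0] at h1
      have h5 := add_left_cancel h1
      exact mul_left_cancel₀ (by simp) h5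
  induction f using Polynomial.induction_on' with
  | add p q hp hq => simp [mul_add, hp, hq, Finset.sum_add_distrib]
  | monomial n c =>
    rw [← C_mul_X_pow_eq_monomial, mul_left_comm, ← smul_eq_C_mul, map_smul, ← pow_succ', key,
      smul_eq_mul, Finset.mul_sum]
    refine Finset.sum_congr rfl fun i _ => ?_
    simp
    ring

/-! ### Vanishing of the operators on the ideal of the points aᵢ. -/

namespace BorelOperators

variable {V : Type*} [AddCommGroup V] [Module ℂ V] {T : BorelOperators V}

namespace IsCyclicHighestWeight

variable {Ψ : V} {D : ℂ[X] →ₗ[ℂ] ℂ}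

/-- An operator commuting with all lowering operators is determined by its value at `Ψ`. -/
theorem eq_of_commute (hΨ : T.IsCyclicHighestWeight Ψ D) {A B : Module.End ℂ V}
    (hA : ∀ f v, A (T.xm f v) = T.xm f (A v)) (hB : ∀ f v, B (T.xm f v) = T.xm f (B v))
    (h : A Ψ = B Ψ) : A = B := by
  have := hΨ.eq_top (LinearMap.eqLocus A B) h fun f v hv => by
    rw [LinearMap.mem_eqLocus] at hv ⊢
    rw [hA, hB, hv]
  exact LinearMap.ext fun v => LinearMap.mem_eqLocus.mp (this ▸ Submodule.mem_top)

theorem xm_eq_zero (hΨ : T.IsCyclicHighestWeight Ψ D) {f : ℂ[X]} (h : T.xm f Ψ = 0) :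
    T.xm f = 0 :=
  hΨ.eq_of_commute (fun _ _ => T.xm_xm_apply _ _ _) (fun _ _ => by simp) (by simpa using h)

/-- Bracketing with `hh g` multiplies the polynomial by g, so the kernel of `xm` is an ideal. -/
theorem xm_mul_eq_zero {f : ℂ[X]} (h : T.xm f = 0)
    (g : ℂ[X]) : T.xm (g * f) = 0 := by
  have h1 := T.hh_mul_xm g f
  rw [h, mul_zero, zero_mul, zero_add] at h1
  exact (smul_eq_zero_iff_right (by norm_num)).mp h1.symm

theorem hh_eq_zero {f : ℂ[X]} (h : T.xm f = 0) : T.hh (X * f) = 0 := by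
  have h1 := T.xp_mul_xm 1 f
  rwa [h, mul_zero, zero_mul, zero_add, one_mul, eq_comm] at h1

variable {r : ℕ} {a : Fin r → ℂ}

/-- Nilpotency kills the left side of `raise_lower_succ` at n = r, so `xm` vanishes at ±∏ (t - aᵢ);
distinctness of the aᵢ makes this product divide f. -/
theorem xm_eq_zero_of_eval (hΨ : T.IsCyclicHighestWeight Ψ D) {l : ℕ → ℂ}
    (hl : ∀ n, T.raise n (T.lower n Ψ) = l n • Ψ) (hr : T.lower (r + 1) Ψ = 0)
    (hla : ∀ k, l k = MvPolynomial.aeval a (MvPolynomial.esymm (Fin r) ℂ k))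
    (ha : Function.Injective a) {f : ℂ[X]} (hf : ∀ i, f.eval (a i) = 0) : T.xm f = 0 := by
  have h1 := hΨ.raise_lower_succ hl r
  rw [hr, map_zero] at h1
  have h2 := hΨ.xm_eq_zero h1.symm
  obtain ⟨g, rfl⟩ : ∏ i, (X - C (a i)) ∣ f :=
    Finset.prod_dvd_of_coprime
      (fun i _ j _ hij => isCoprime_X_sub_C_of_isUnit_sub
        (sub_ne_zero.mpr fun h => hij (ha h)).isUnit)
      fun i _ => dvd_iff_isRoot.mpr (hf i)
  rw [garlandPoly_eq_prod a l hla, mul_comm _ g, ← mul_assoc]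
  exact xm_mul_eq_zero h2 _

end IsCyclicHighestWeight

/-! ### Commuting sl₂-triples attached to the points aᵢ. -/

/-- The operators act through evaluation at the points `a`. -/
structure FactorsThroughEval {r : ℕ} (T : BorelOperators V) (D : ℂ[X] →ₗ[ℂ] ℂ)
    (a : Fin r → ℂ) : Prop where
  injective : Function.Injective a
  ne_zero : ∀ i, a i ≠ 0
  xm_eq_zero : ∀ f : ℂ[X], (∀ i, f.eval (a i) = 0) → T.xm f = 0
  weight_eq : ∀ f, D (X * f) = ∑ i, a i * f.eval (a i)

/-- The polynomial with values `(a i)⁻¹` at `a i` and `0` at the other points. -/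
noncomputable def dualPoly {r : ℕ} (a : Fin r → ℂ) (i : Fin r) : ℂ[X] :=
  C (a i)⁻¹ * Lagrange.basis Finset.univ a i

namespace FactorsThroughEval

variable {r : ℕ} {a : Fin r → ℂ} {Ψ : V} {D : ℂ[X] →ₗ[ℂ] ℂ}

/-- The normalisation absorbs the factor t in `xm f` = x⁻(t f): at the points, t times `dualPoly a
i` is the i-th idempotent. -/
theorem eval_dualPoly (hT : FactorsThroughEval T D a) (i j : Fin r) :
    a j * (dualPoly a i).eval (a j) = if i = j then 1 else 0 := by
  rw [dualPoly, eval_mul, eval_C]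
  split_ifs with h
  · subst h
    rw [Lagrange.eval_basis_self hT.injective.injOn (Finset.mem_univ i), mul_one,
      mul_inv_cancel₀ (hT.ne_zero i)]
  · rw [Lagrange.eval_basis_of_ne h (Finset.mem_univ j), mul_zero, mul_zero]

theorem eval_dualPoly_of_ne (hT : FactorsThroughEval T D a) {i j : Fin r} (h : i ≠ j) :
    (dualPoly a i).eval (a j) = 0 :=
  (mul_eq_zero.mp ((hT.eval_dualPoly i j).trans (if_neg h))).resolve_left (hT.ne_zero j)

theorem hh_eq_zero (hT : FactorsThroughEval T D a) {f : ℂ[X]} (hf : ∀ i, f.eval (a i) = 0) :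
    T.hh (X * f) = 0 :=
  IsCyclicHighestWeight.hh_eq_zero (hT.xm_eq_zero f hf)

/-- Bracket with x₀⁺. The factor `X` is inherited from `hh_eq_zero`, which controls only multiples
of t. -/
theorem xp_eq_zero (hT : FactorsThroughEval T D a) {f : ℂ[X]} (hf : ∀ i, f.eval (a i) = 0) :
    T.xp (X * f) = 0 := by
  have h1 := T.hh_mul_xp (X * f) 1
  rw [hT.hh_eq_zero hf, zero_mul, mul_zero, zero_add, mul_one] at h1
  exact (smul_eq_zero_iff_right (by norm_num)).mp h1.symm

theorem xm_congr (hT : FactorsThroughEval T D a) {f g : ℂ[X]}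
    (h : ∀ i, f.eval (a i) = g.eval (a i)) : T.xm f = T.xm g := by
  rw [← sub_eq_zero, ← map_sub]
  exact hT.xm_eq_zero _ fun i => by rw [eval_sub, h, sub_self]

theorem hh_congr (hT : FactorsThroughEval T D a) {f g : ℂ[X]}
    (h : ∀ i, f.eval (a i) = g.eval (a i)) : T.hh (X * f) = T.hh (X * g) := by
  rw [← sub_eq_zero, ← map_sub, ← mul_sub]
  exact hT.hh_eq_zero fun i => by rw [eval_sub, h, sub_self]

theorem xp_congr (hT : FactorsThroughEval T D a) {f g : ℂ[X]}
    (h : ∀ i, f.eval (a i) = g.eval (a i)) : T.xp (X * f) = T.xp (X * g) := by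
  rw [← sub_eq_zero, ← map_sub, ← mul_sub]
  exact hT.xp_eq_zero fun i => by rw [eval_sub, h, sub_self]

/-- The lowering operator at the point `a i`. -/
noncomputable def y (T : BorelOperators V) (a : Fin r → ℂ) (i : Fin r) : Module.End ℂ V :=
  T.xm (dualPoly a i)

/-- The raising operator at the point `a i`. -/
noncomputable def x (T : BorelOperators V) (a : Fin r → ℂ) (i : Fin r) : Module.End ℂ V :=
  T.xp (X * dualPoly a i)

/-- The weight operator at the point `a i`. -/
noncomputable def w (T : BorelOperators V) (a : Fin r → ℂ) (i : Fin r) : Module.End ℂ V :=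
  T.hh (X * dualPoly a i)

theorem x_y_self (hT : FactorsThroughEval T D a) (i : Fin r) (v : V) :
    x T a i (y T a i v) = y T a i (x T a i v) + w T a i v := by
  rw [x, y, xp_xm_apply, w]
  congr 2
  refine hT.hh_congr fun j => ?_
  rw [eval_mul, eval_mul, eval_X, hT.eval_dualPoly]
  split_ifs with h
  · rw [one_mul]
  · rw [zero_mul, hT.eval_dualPoly_of_ne h]

theorem x_y_of_ne (hT : FactorsThroughEval T D a) {i j : Fin r} (hij : i ≠ j) (v : V) :
    x T a i (y T a j v) = y T a j (x T a i v) := by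
  rw [x, y, xp_xm_apply, hT.hh_eq_zero, LinearMap.zero_apply, add_zero]
  intro k
  rw [eval_mul, eval_mul, eval_X, hT.eval_dualPoly]
  split_ifs with h
  · rw [hT.eval_dualPoly_of_ne (h ▸ hij.symm), mul_zero]
  · rw [zero_mul]

theorem w_y_self (hT : FactorsThroughEval T D a) (i : Fin r) (v : V) :
    w T a i (y T a i v) = y T a i (w T a i v) + (-2 : ℂ) • y T a i v := by
  rw [w, y, hh_xm_apply]
  congr 3
  refine hT.xm_congr fun j => ?_
  rw [eval_mul, eval_mul, eval_X, hT.eval_dualPoly]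
  split_ifs with h
  · rw [one_mul]
  · rw [zero_mul, hT.eval_dualPoly_of_ne h]

theorem w_y_of_ne (hT : FactorsThroughEval T D a) {i j : Fin r} (hij : i ≠ j) (v : V) :
    w T a i (y T a j v) = y T a j (w T a i v) := by
  have h0 : T.xm (X * dualPoly a i * dualPoly a j) = 0 := by
    refine hT.xm_eq_zero _ fun k => ?_
    rw [eval_mul, eval_mul, eval_X, hT.eval_dualPoly]
    split_ifs with h
    · rw [hT.eval_dualPoly_of_ne (h ▸ hij.symm), mul_zero]
    · rw [zero_mul]
  rw [w, y, hh_xm_apply, h0, LinearMap.zero_apply, smul_zero, add_zero]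

theorem w_x_self (hT : FactorsThroughEval T D a) (i : Fin r) :
    w T a i * x T a i = x T a i * w T a i + (2 : ℂ) • x T a i := by
  have h0 : T.xp (X * dualPoly a i * (X * dualPoly a i)) = T.xp (X * dualPoly a i) := by
    rw [mul_assoc]
    refine hT.xp_congr fun j => ?_
    rw [eval_mul, eval_mul, eval_X, hT.eval_dualPoly]
    split_ifs with h
    · rw [mul_one]
    · rw [mul_zero, hT.eval_dualPoly_of_ne h]
  rw [w, x, hh_mul_xp, h0]

theorem w_apply (hT : FactorsThroughEval T D a) (hΨ : T.IsCyclicHighestWeight Ψ D) (i : Fin r) :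
    w T a i Ψ = Ψ := by
  rw [w, hΨ.hh_apply, hT.weight_eq]
  simp_rw [hT.eval_dualPoly]
  simp

section Lie

attribute [local instance] LieRing.ofAssociativeRing

theorem isSl2Triple (hT : FactorsThroughEval T D a) (hΨ : T.IsCyclicHighestWeight Ψ D)
    (i : Fin r) : IsSl2Triple (w T a i) (x T a i) (y T a i) where
  h_ne_zero h := hΨ.ne_zero <| by rw [← hT.w_apply hΨ i, h, LinearMap.zero_apply]
  lie_e_f := LinearMap.ext fun v => by
    rw [Ring.lie_def, LinearMap.sub_apply, Module.End.mul_apply, Module.End.mul_apply,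
      hT.x_y_self, add_sub_cancel_left]
  lie_h_e_nsmul := by
    rw [Ring.lie_def, hT.w_x_self, add_sub_cancel_left, ← Nat.cast_smul_eq_nsmul ℂ, Nat.cast_ofNat]
  lie_h_f_nsmul := LinearMap.ext fun v => by
    rw [Ring.lie_def, LinearMap.sub_apply, Module.End.mul_apply, Module.End.mul_apply,
      hT.w_y_self, add_sub_cancel_left, ← Nat.cast_smul_eq_nsmul ℂ, Nat.cast_ofNat, neg_smul]
    rfl

/-- Ψ is primitive of weight 1 for the i-th triple, so yᵢ² Ψ = 0 by finite dimension; yᵢ² commutes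
with all lowering operators, hence vanishes everywhere. -/
theorem y_y (hT : FactorsThroughEval T D a) (hΨ : T.IsCyclicHighestWeight Ψ D)
    [FiniteDimensional ℂ V] (i : Fin r) (v : V) : y T a i (y T a i v) = 0 := by
  have P : (hT.isSl2Triple hΨ i).HasPrimitiveVectorWith Ψ (1 : ℂ) :=
    ⟨hΨ.ne_zero, by rw [one_smul]; exact hT.w_apply hΨ i, hΨ.xp_apply _⟩
  have h := P.pow_toEnd_f_eq_zero_of_eq_nat (n := 1) (by simp)
  have h2 : y T a i * y T a i = 0 := by
    refine hΨ.eq_of_commute (fun f v => ?_) (fun _ _ => by simp) ?_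
    · rw [Module.End.mul_apply, Module.End.mul_apply, y, xm_xm_apply _ _ f, xm_xm_apply _ _ f]
    · rw [pow_succ, pow_one] at h
      exact h
  exact LinearMap.congr_fun h2 v

end Lie

/-! ### Spanning by products of distinct yᵢ, and raising back to Ψ. -/

/-- The span of the products of the lowering operators in the list applied to `Ψ`. -/
noncomputable def layer (T : BorelOperators V) (a : Fin r → ℂ) (Ψ : V) :
    List (Fin r) → Submodule ℂ V
  | [] => ℂ ∙ Ψ
  | i :: L => layer T a Ψ L ⊔ (layer T a Ψ L).map (y T a i)

theorem mem_layer_cons {i : Fin r} {L : List (Fin r)} {v : V} :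
    v ∈ layer T a Ψ (i :: L) ↔ ∃ u ∈ layer T a Ψ L, ∃ z ∈ layer T a Ψ L, u + y T a i z = v := by
  rw [layer, Submodule.mem_sup]
  simp

/-- Since xᵢ commutes with yⱼ for j ≠ i, a vector built without yᵢ is annihilated by xᵢ just as Ψ
is. -/
theorem x_layer (hT : FactorsThroughEval T D a) (hΨ : T.IsCyclicHighestWeight Ψ D)
    {i : Fin r} {L : List (Fin r)} (hi : i ∉ L) {v : V} (hv : v ∈ layer T a Ψ L) :
    x T a i v = 0 := by
  induction L generalizing v with
  | nil =>
    obtain ⟨c, rfl⟩ := Submodule.mem_span_singleton.mp hv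
    rw [map_smul, x, hΨ.xp_apply, smul_zero]
  | cons j L ih =>
    obtain ⟨hj, hi⟩ := List.ne_and_not_mem_of_not_mem_cons hi
    obtain ⟨u, hu, z, hz, rfl⟩ := mem_layer_cons.mp hv
    rw [map_add, hT.x_y_of_ne hj, ih hi hu, ih hi hz, map_zero, add_zero]

theorem w_layer (hT : FactorsThroughEval T D a) (hΨ : T.IsCyclicHighestWeight Ψ D)
    {i : Fin r} {L : List (Fin r)} (hi : i ∉ L) {v : V} (hv : v ∈ layer T a Ψ L) :
    w T a i v = v := by
  induction L generalizing v with
  | nil =>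
    obtain ⟨c, rfl⟩ := Submodule.mem_span_singleton.mp hv
    rw [map_smul, hT.w_apply hΨ]
  | cons j L ih =>
    obtain ⟨hj, hi⟩ := List.ne_and_not_mem_of_not_mem_cons hi
    obtain ⟨u, hu, z, hz, rfl⟩ := mem_layer_cons.mp hv
    rw [map_add, hT.w_y_of_ne hj, ih hi hu, ih hi hz]

theorem y_layer (hT : FactorsThroughEval T D a) (hΨ : T.IsCyclicHighestWeight Ψ D)
    [FiniteDimensional ℂ V] {i : Fin r} {L : List (Fin r)} (hi : i ∈ L) {v : V}
    (hv : v ∈ layer T a Ψ L) : y T a i v ∈ layer T a Ψ L := by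
  induction L generalizing v with
  | nil => simp at hi
  | cons j L ih =>
    obtain ⟨u, hu, z, hz, rfl⟩ := mem_layer_cons.mp hv
    by_cases hij : i = j
    · subst hij
      exact mem_layer_cons.mpr ⟨0, zero_mem _, u, hu, by rw [map_add, hT.y_y hΨ, zero_add, add_zero]⟩
    · have hi := List.mem_of_ne_of_mem hij hi
      refine mem_layer_cons.mpr ⟨_, ih hi hu, _, ih hi hz, ?_⟩
      rw [map_add]
      congr 1
      exact T.xm_xm_apply _ _ _

theorem mem_layer_self (L : List (Fin r)) : Ψ ∈ layer T a Ψ L := by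
  induction L with
  | nil => exact Submodule.mem_span_singleton_self Ψ
  | cons i L ih => exact Submodule.mem_sup_left ih

theorem layer_finRange (hT : FactorsThroughEval T D a) (hΨ : T.IsCyclicHighestWeight Ψ D)
    [FiniteDimensional ℂ V] : layer T a Ψ (List.finRange r) = ⊤ := by
  refine hΨ.eq_top _ (mem_layer_self _) fun f v hv => ?_
  -- Lagrange interpolation of f at the points aᵢ.
  have : T.xm f = ∑ i, (a i * f.eval (a i)) • y T a i := by
    simp_rw [y, ← map_smul, ← map_sum]
    refine hT.xm_congr fun j => ?_
    simp_rw [eval_finsetSum, eval_smul, smul_eq_mul]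
    rw [Finset.sum_eq_single j]
    · rw [mul_right_comm, hT.eval_dualPoly, if_pos rfl, one_mul]
    · intro i _ hi
      rw [hT.eval_dualPoly_of_ne hi, mul_zero]
    · simp
  rw [this, LinearMap.sum_apply]
  exact Submodule.sum_mem _ fun i _ => Submodule.smul_mem _ _ <|
    hT.y_layer hΨ (List.mem_finRange i) hv

/-- A nonzero vector generates `Ψ` under the raising operators. -/
theorem mem_of_ne_zero (hT : FactorsThroughEval T D a) (hΨ : T.IsCyclicHighestWeight Ψ D)
    {W : Submodule ℂ V} (hW : ∀ f, ∀ v ∈ W, T.xp f v ∈ W) {L : List (Fin r)} (hL : L.Nodup)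
    {v : V} (hv : v ∈ layer T a Ψ L) (hvW : v ∈ W) (h0 : v ≠ 0) : Ψ ∈ W := by
  induction L generalizing v with
  | nil =>
    obtain ⟨c, rfl⟩ := Submodule.mem_span_singleton.mp hv
    exact (W.smul_mem_iff fun hc => h0 (by rw [hc, zero_smul])).mp hvW
  | cons i L ih =>
    obtain ⟨hi, hL⟩ := List.nodup_cons.mp hL
    obtain ⟨u, hu, z, hz, rfl⟩ := mem_layer_cons.mp hv
    -- Neither u nor z involves yᵢ, so xᵢ kills both, and xᵢ yᵢ z = wᵢ z = z. If z = 0, the vector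
    -- already lies in the smaller layer.
    have hx : x T a i (u + y T a i z) = z := by
      rw [map_add, hT.x_layer hΨ hi hu, hT.x_y_self, hT.x_layer hΨ hi hz, map_zero, zero_add,
        zero_add, hT.w_layer hΨ hi hz]
    by_cases hz0 : z = 0
    · rw [hz0, map_zero, add_zero] at hvW h0
      exact ih hL hu hvW h0
    · exact ih hL hz (hx ▸ hW _ _ hvW) hz0

end FactorsThroughEval

end BorelOperators

/-! ### Realisation of the operators by the action of U(B). -/

theorem xMinus_mul_xMinus (j k : ℕ) (hj : 0 < j) (hk : 0 < k) :
    xMinus j hj * xMinus k hk = xMinus k hk * xMinus j hj := by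
  apply Subtype.ext
  have e := toULoop_mul_sub (loopXMinus j) (loopXMinus k)
  rw [lie_loopXMinus_loopXMinus, sub_eq_iff_eq_add'] at e
  simpa [xMinus] using e

theorem xPlus_mul_xPlus (j k : ℕ) : xPlus j * xPlus k = xPlus k * xPlus j := by
  apply Subtype.ext
  have e := toULoop_mul_sub (loopXPlus j) (loopXPlus k)
  rw [lie_loopXPlus_loopXPlus, sub_eq_iff_eq_add'] at e
  simpa [xPlus] using e

theorem h_mul_xPlus (j k : ℕ) :
    h j * xPlus k = xPlus k * h j + (2 : ℂ) • xPlus (j + k) := by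
  apply Subtype.ext
  have e := toULoop_mul_sub (loopH j) (loopXPlus k)
  rw [lie_loopH_loopXPlus, sub_eq_iff_eq_add', toULoop_smul] at e
  simpa [xPlus, h] using e

/-- The linear map on polynomials sending `t ^ k` to `F k`. -/
noncomputable def monomialLift {E : Type*} [AddCommGroup E] [Module ℂ E] (F : ℕ → E) :
    ℂ[X] →ₗ[ℂ] E :=
  (Polynomial.basisMonomials ℂ).constr ℂ F

theorem monomialLift_monomial {E : Type*} [AddCommGroup E] [Module ℂ E] (F : ℕ → E) (k : ℕ)
    (c : ℂ) : monomialLift F (monomial k c) = c • F k := by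
  have h1 : monomial k c = c • (Polynomial.basisMonomials ℂ) k := by
    simp [Polynomial.coe_basisMonomials, smul_monomial]
  rw [h1, map_smul, monomialLift, Module.Basis.constr_basis]

section Operators

variable {V : Type*} [AddCommGroup V] [Module ℂ V] [Module borel V] [IsScalarTower ℂ borel V]

/-- The operator on `V` given by an element of `U(B)`. -/
noncomputable def action (V : Type*) [AddCommGroup V] [Module ℂ V] [Module borel V]
    [IsScalarTower ℂ borel V] : borel →ₐ[ℂ] Module.End ℂ V :=
  haveI : SMulCommClass borel ℂ V := ⟨fun b c v => smul_comm_complex b c v⟩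
  Algebra.lsmul ℂ ℂ V

theorem action_apply (b : borel) (v : V) : action V b v = b • v := rfl

/-- The operators of `U(B)` on `V`, indexed by polynomials. -/
noncomputable def borelOperators (V : Type*) [AddCommGroup V] [Module ℂ V] [Module borel V]
    [IsScalarTower ℂ borel V] : BorelOperators V where
  xp := monomialLift fun k => action V (xPlus k)
  hh := monomialLift fun k => action V (h k)
  xm := monomialLift fun k => action V (xMinus (k + 1) k.succ_pos)
  xp_mul_xm f g := by
    induction f using Polynomial.induction_on' with
    | add p q hp hq => simp only [add_mul, mul_add, map_add, hp, hq]; abel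
    | monomial j b =>
      induction g using Polynomial.induction_on' with
      | add p q hp hq => simp only [add_mul, mul_add, map_add, hp, hq]; abel
      | monomial k c =>
        rw [← monomial_one_one_eq_X, monomial_mul_monomial, monomial_mul_monomial]
        simp only [monomialLift_monomial, smul_mul_smul_comm, ← map_mul, xPlus_mul_xMinus, map_add,
          one_mul]
        -- The `X` in `xp_mul_xm` accounts for t^k corresponding to x⁻ of index k + 1.
        rw [show 1 + (j + k) = j + (k + 1) by ring]
        module
  hh_mul_xm f g := by
    induction f using Polynomial.induction_on' with
    | add p q hp hq => simp only [add_mul, mul_add, map_add, hp, hq]; module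
    | monomial j b =>
      induction g using Polynomial.induction_on' with
      | add p q hp hq => simp only [add_mul, mul_add, map_add, hp, hq]; module
      | monomial k c =>
        rw [monomial_mul_monomial]
        simp only [monomialLift_monomial, smul_mul_smul_comm, ← map_mul, h_mul_xMinus, map_add,
          map_smul, ← add_assoc]
        module
  hh_mul_xp f g := by
    induction f using Polynomial.induction_on' with
    | add p q hp hq => simp only [add_mul, mul_add, map_add, hp, hq]; module
    | monomial j b =>
      induction g using Polynomial.induction_on' with
      | add p q hp hq => simp only [add_mul, mul_add, map_add, hp, hq]; module
      | monomial k c =>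
        rw [monomial_mul_monomial]
        simp only [monomialLift_monomial, smul_mul_smul_comm, ← map_mul, h_mul_xPlus, map_add,
          map_smul]
        module
  xm_mul_xm f g := by
    induction f using Polynomial.induction_on' with
    | add p q hp hq => simp only [add_mul, mul_add, map_add, hp, hq]
    | monomial j b =>
      induction g using Polynomial.induction_on' with
      | add p q hp hq => simp only [add_mul, mul_add, map_add, hp, hq]
      | monomial k c =>
        simp only [monomialLift_monomial, smul_mul_smul_comm, ← map_mul]
        rw [xMinus_mul_xMinus, mul_comm b]
  xp_mul_xp f g := by
    induction f using Polynomial.induction_on' with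
    | add p q hp hq => simp only [add_mul, mul_add, map_add, hp, hq]
    | monomial j b =>
      induction g using Polynomial.induction_on' with
      | add p q hp hq => simp only [add_mul, mul_add, map_add, hp, hq]
      | monomial k c =>
        simp only [monomialLift_monomial, smul_mul_smul_comm, ← map_mul]
        rw [xPlus_mul_xPlus, mul_comm b]

theorem borelOperators_xp_monomial (k : ℕ) (c : ℂ) :
    (borelOperators V).xp (monomial k c) = c • action V (xPlus k) :=
  monomialLift_monomial _ k c

theorem borelOperators_hh_monomial (k : ℕ) (c : ℂ) :
    (borelOperators V).hh (monomial k c) = c • action V (h k) :=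
  monomialLift_monomial _ k c

theorem borelOperators_xm_monomial (k : ℕ) (c : ℂ) :
    (borelOperators V).xm (monomial k c) = c • action V (xMinus (k + 1) k.succ_pos) :=
  monomialLift_monomial _ k c

theorem borelOperators_xp_one : (borelOperators V).xp 1 = action V (xPlus 0) := by
  rw [← monomial_zero_one, borelOperators_xp_monomial, one_smul]

theorem borelOperators_xm_one : (borelOperators V).xm 1 = action V (xMinus 1 one_pos) := by
  rw [← monomial_zero_one, borelOperators_xm_monomial, one_smul]

theorem raise_apply (n : ℕ) (v : V) :
    (borelOperators V).raise n v = divPow (xPlus 0) n • v := by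
  rw [← action_apply, divPow, map_smul, map_pow, ← borelOperators_xp_one]
  rfl

theorem lower_apply (n : ℕ) (v : V) :
    (borelOperators V).lower n v = divPow (xMinus 1 one_pos) n • v := by
  rw [← action_apply, divPow, map_smul, map_pow, ← borelOperators_xm_one]
  rfl

/-- A subspace stable under `h₀`, `x₀⁺` and `x₁⁻` is stable under `U(B)`. -/
theorem borel_smul_mem {N : Submodule ℂ V} (hh : ∀ v ∈ N, h 0 • v ∈ N)
    (hp : ∀ v ∈ N, xPlus 0 • v ∈ N) (hm : ∀ v ∈ N, xMinus 1 one_pos • v ∈ N) (b : borel) :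
    ∀ v ∈ N, b • v ∈ N := by
  obtain ⟨b, hb⟩ := b
  induction hb using Algebra.adjoin_induction with
  | mem x hx =>
    rcases hx with rfl | rfl | rfl
    · exact hh
    · exact hp
    · exact hm
  | algebraMap c =>
    intro v hv
    have : (⟨algebraMap ℂ ULoop c, borel.algebraMap_mem c⟩ : borel) = c • 1 :=
      Subtype.ext (Algebra.algebraMap_eq_smul_one c)
    change (⟨algebraMap ℂ ULoop c, borel.algebraMap_mem c⟩ : borel) • v ∈ N
    rw [this, smul_assoc, one_smul]
    exact N.smul_mem c hv
  | add x y hx hy ihx ihy =>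
    intro v hv
    change ((⟨x, hx⟩ : borel) + ⟨y, hy⟩) • v ∈ N
    rw [add_smul]
    exact N.add_mem (ihx v hv) (ihy v hv)
  | mul x y hx hy ihx ihy =>
    intro v hv
    change ((⟨x, hx⟩ : borel) * ⟨y, hy⟩) • v ∈ N
    rw [mul_smul]
    exact ihx _ (ihy v hv)

namespace IsHighestWeightVector

variable {Ψ : V} {d : ℕ → ℂ}

/-- The sum of the sectors contains Ψ and is stable under the three generators of U(B). This shows
that lowering operators alone generate V. -/
theorem iSup_sector_eq_top (hΨ : IsHighestWeightVector Ψ d)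
    (hgen : Submodule.span borel {Ψ} = ⊤) : ⨆ n, sector Ψ n = ⊤ := by
  have stable : ∀ b : borel, (∀ n, ∀ v ∈ sector Ψ n, b • v ∈ ⨆ n, sector Ψ n) →
      ∀ v ∈ ⨆ n, sector Ψ n, b • v ∈ ⨆ n, sector Ψ n := by
    intro b hb v hv
    have : ⨆ n, sector Ψ n ≤ (⨆ n, sector Ψ n).comap (action V b) := iSup_le hb
    exact this hv
  have hall := borel_smul_mem (N := ⨆ n, sector Ψ n)
    (stable _ fun n v hv => Submodule.mem_iSup_of_mem n (hΨ.h_smul_mem_sector n 0 hv))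
    (stable _ fun n v hv => by
      cases n with
      | zero =>
        obtain ⟨c, rfl⟩ := Submodule.mem_span_singleton.mp hv
        rw [smul_comm_complex, hΨ.xPlus_smul, smul_zero]
        exact zero_mem _
      | succ n => exact Submodule.mem_iSup_of_mem n (hΨ.xPlus_smul_mem_sector n 0 hv))
    (stable _ fun n v hv =>
      Submodule.mem_iSup_of_mem (n + 1) (xMinus_smul_mem_sector Ψ n 1 one_pos hv))
  refine eq_top_iff.mpr fun v _ => ?_
  obtain ⟨b, rfl⟩ := Submodule.mem_span_singleton.mp (hgen ▸ Submodule.mem_top : v ∈ _)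
  exact hall b Ψ (Submodule.mem_iSup_of_mem 0 (Submodule.mem_span_singleton_self Ψ))

theorem isCyclicHighestWeight (hΨ : IsHighestWeightVector Ψ d)
    (hgen : Submodule.span borel {Ψ} = ⊤) :
    (borelOperators V).IsCyclicHighestWeight Ψ (monomialLift d) where
  ne_zero := hΨ.ne_zero
  xp_apply f := by
    induction f using Polynomial.induction_on' with
    | add p q hp hq => rw [map_add, LinearMap.add_apply, hp, hq, add_zero]
    | monomial k c =>
      rw [borelOperators_xp_monomial, LinearMap.smul_apply, action_apply, hΨ.xPlus_smul, smul_zero]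
  hh_apply f := by
    induction f using Polynomial.induction_on' with
    | add p q hp hq => rw [map_add, LinearMap.add_apply, hp, hq, map_add, add_smul]
    | monomial k c =>
      rw [borelOperators_hh_monomial, LinearMap.smul_apply, action_apply, hΨ.h_smul,
        monomialLift_monomial, smul_assoc]
  eq_top N h0 hN := by
    rw [eq_top_iff, ← hΨ.iSup_sector_eq_top hgen]
    refine iSup_le fun n => ?_
    induction n with
    | zero => exact (Submodule.span_singleton_le_iff_mem Ψ N).mpr h0
    | succ n ih =>
      refine Submodule.span_le.mpr ?_
      rintro _ ⟨k, hk, v, hv, rfl⟩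
      obtain ⟨k, rfl⟩ := Nat.exists_eq_succ_of_ne_zero hk.ne'
      have := hN (monomial k 1) v (ih hv)
      rwa [borelOperators_xm_monomial, one_smul] at this

end IsHighestWeightVector

theorem raise_lower_eq_lam {Ψ : V} {d : ℕ → ℂ} (hΨ : IsHighestWeightVector Ψ d) (n : ℕ) :
    (borelOperators V).raise n ((borelOperators V).lower n Ψ) = lam Ψ n • Ψ := by
  rw [lower_apply, raise_apply, ← mul_smul, hΨ.lam_spec]

theorem NilpotentOfDegree.lower_eq_zero {Ψ : V} {r n : ℕ} (hr : NilpotentOfDegree Ψ r)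
    (hn : r < n) : (borelOperators V).lower n Ψ = 0 := by
  obtain ⟨m, rfl⟩ := Nat.exists_eq_add_of_lt hn
  rw [lower_apply, divPow, smul_assoc, show r + m + 1 = m + (r + 1) by ring, pow_add, mul_smul,
    hr.1, smul_zero, smul_zero]

theorem HasEvaluationParameters.lam_eq {Ψ : V} {d : ℕ → ℂ} (hΨ : IsHighestWeightVector Ψ d)
    {r : ℕ} (hr : NilpotentOfDegree Ψ r) {a : Fin r → ℂ} (ha : HasEvaluationParameters Ψ r a)
    (k : ℕ) : lam Ψ k = MvPolynomial.aeval a (MvPolynomial.esymm (Fin r) ℂ k) := by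
  rcases Nat.lt_or_ge k (r + 1) with hk | hk
  · rw [HasEvaluationParameters, drinfeldPoly, prod_one_sub_C_mul_X] at ha
    have h1 := congrArg (fun p => p.coeff k) ha
    simp only [coeff_sum_C_mul_neg_X_pow _ _ _ hk] at h1
    exact mul_left_cancel₀ (by simp) h1
  -- Beyond degree r the polynomial carries no information: λ_k vanishes by nilpotency, and the
  -- symmetric function because r indices have no k-element subset.
  · have h1 := raise_lower_eq_lam hΨ k
    rw [hr.lower_eq_zero hk, map_zero, eq_comm] at h1
    rw [(smul_eq_zero.mp h1).resolve_right hΨ.ne_zero, MvPolynomial.esymm,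
      Finset.powersetCard_eq_empty.mpr (by simpa using hk), Finset.sum_empty, map_zero]

end Operators

end SlTwoLoop

theorem mainTheorem1 {V : Type*} [AddCommGroup V] [Module ℂ V] [Module SlTwoLoop.borel V]
    [IsScalarTower ℂ SlTwoLoop.borel V] [FiniteDimensional ℂ V]
    (Ψ : V) (d : ℕ → ℂ) (hΨ : SlTwoLoop.IsHighestWeightVector Ψ d)
    (hgen : Submodule.span SlTwoLoop.borel {Ψ} = ⊤)
    (r : ℕ) (hr : SlTwoLoop.NilpotentOfDegree Ψ r)
    (a : Fin r → ℂ) (ha : SlTwoLoop.HasEvaluationParameters Ψ r a)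
    (hdistinct : Function.Injective a) (hnonzero : ∀ i, a i ≠ 0) :
    IsSimpleModule SlTwoLoop.borel V := by
  have hC := hΨ.isCyclicHighestWeight hgen
  have hlam := SlTwoLoop.raise_lower_eq_lam hΨ
  have hesymm := SlTwoLoop.HasEvaluationParameters.lam_eq hΨ hr ha
  have hT : (SlTwoLoop.borelOperators V).FactorsThroughEval (SlTwoLoop.monomialLift d) a :=
    { injective := hdistinct
      ne_zero := hnonzero
      xm_eq_zero := fun f hf =>
        hC.xm_eq_zero_of_eval hlam (hr.lower_eq_zero r.lt_succ_self) hesymm hdistinct hf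
      weight_eq := SlTwoLoop.eq_sum_eval_of_newton a _ hesymm _ (hC.weight_garlandPoly hlam) }
  have : Nontrivial V := ⟨⟨Ψ, 0, hΨ.ne_zero⟩⟩
  rw [isSimpleModule_iff_toSpanSingleton_surjective]
  refine ⟨this, fun v hv => ?_⟩
  rw [← LinearMap.range_eq_top, LinearMap.range_toSpanSingleton, eq_top_iff, ← hgen,
    Submodule.span_singleton_le_iff_mem]
  -- It suffices that the submodule generated by v ≠ 0 contains Ψ; only its stability under raising
  -- operators is needed.
  refine hT.mem_of_ne_zero hC (W := (Submodule.span SlTwoLoop.borel {v}).restrictScalars ℂ)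
    (fun f u hu => ?_) (List.nodup_finRange r)
    (hT.layer_finRange hC ▸ Submodule.mem_top : v ∈ _) (Submodule.mem_span_singleton_self v) hv
  induction f using Polynomial.induction_on' with
  | add p q hp hq => rw [map_add]; exact add_mem hp hq
  | monomial k c =>
    rw [SlTwoLoop.borelOperators_xp_monomial]
    exact Submodule.smul_mem _ c (Submodule.smul_mem (Submodule.span SlTwoLoop.borel {v}) _ hu)
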